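/- A *system* $\mathbf A=(A,\mu,\alpha)$ consists of a von Neumann algebra $A$, a faithful normal (finite) trace $\mu$ on $A$, and a $*$-automorphism $\alpha$ of $A$ with $\mu\circ\alpha=\mu$. A system $\mathbf F=(F,\lambda,\varphi)$ is a *subsystem* of $\mathbf A$ if $F$ is a von Neumann subalgebra of $A$ containing the unit of $A$, $\mu|_F=\lambda$ and $\alpha|_F=\varphi$. Let $A$ be represented on the Hilbert space $H$ with a cyclic and separating vector $\Omega$ such that $\mu(a)=\langle\Omega,a\Omega\rangle$ for all $a\in A$ (the GNS representation of $\mu$). Let $U$ be the unitary operator on $H$ with $Ua\Omega=\alpha(a)\Omega$, let $J$ be the modular conjugation, $Ja\Omega=a^*\Omega$, and let $H$ carry the right action $xa:=Ja^*Jx$ of $A$. Let $H_F=\overline{F\Omega}$, let $e$ be the projection of $H$ onto $H_F$, let $\langle A,e\rangle$ be the von Neumann algebra on $H$ generated by $A$ and $e$ (the basic construction), and let $\bar\mu:\langle A,e\rangle^+\to[0,\infty]$ be its canonical faithful semifinite normal tracial weight, determined by $\bar\mu(aeb)=\mu(ab)$ for $a,b\in A$. A *$U$-$\bar\mu$-module*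 is a closed subspace $V\subseteq H\ominus H_F$ with $UV=V$ and $VF\subseteq V$, whose orthogonal projection $P_V$ (which then lies in $\langle A,e\rangle$) satisfies $\bar\mu(P_V)<\infty$. The system $\mathbf A$ has *discrete spectrum relative to* $\mathbf F$ if the closed linear span of all $U$-$\bar\mu$-modules is $H\ominus H_F$. **Corollary.** If $\mathbf A=(A,\mu,\alpha)$ is a system for which $A$ is finite-dimensional, then $\mathbf A$ has discrete spectrum relative to every subsystem $\mathbf F$ of $\mathbf A$. -/

import Mathlib

open scoped InnerProductSpace ComplexOrder

noncomputable section

/-- A system `(A, μ, α)`: a von Neumann algebra `A` on a Hilbert space `K`, a faithful normal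
(finite, positive, not necessarily normalized) trace `μ` on `A`, and a `*`-automorphism `α` of `A`
such that `μ ∘ α = μ`. -/
structure WStarSystem (K : Type*) [NormedAddCommGroup K] [InnerProductSpace ℂ K]
    [CompleteSpace K] where
  /-- the von Neumann algebra `A` -/
  alg : VonNeumannAlgebra K
  /-- the trace `μ` -/
  trace : alg.toStarSubalgebra →ₗ[ℂ] ℂ
  trace_nonneg : ∀ a, 0 ≤ trace (star a * a)
  trace_faithful : ∀ a, trace (star a * a) = 0 → a = 0
  trace_comm : ∀ a b, trace (a * b) = trace (b * a)
  /-- normality: `μ` preserves suprema of bounded increasing nets of positive elements -/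
  trace_normal : ∀ (D : Set alg.toStarSubalgebra) (a : alg.toStarSubalgebra), D.Nonempty →
    DirectedOn (fun x y : alg.toStarSubalgebra => (x : K →L[ℂ] K) ≤ (y : K →L[ℂ] K)) D →
    (∀ x ∈ D, 0 ≤ (x : K →L[ℂ] K)) →
    IsLUB (Subtype.val '' D) (a : K →L[ℂ] K) →
    IsLUB ((fun x => (trace x).re) '' D) (trace a).re
  /-- the dynamics `α` -/
  aut : alg.toStarSubalgebra ≃⋆ₐ[ℂ] alg.toStarSubalgebra
  trace_aut : ∀ a, trace (aut a) = trace a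

namespace WStarSystem

variable {K : Type*} [NormedAddCommGroup K] [InnerProductSpace ℂ K] [CompleteSpace K]
variable {H : Type*} [NormedAddCommGroup H] [InnerProductSpace ℂ H] [CompleteSpace H]

/-- The underlying algebra `A` of a system, as a type. -/
abbrev Carrier (S : WStarSystem K) : Type _ := S.alg.toStarSubalgebra

/-- `F = (F, lam, φ)` is a subsystem of `S = (A, μ, α)`: `F` is a von Neumann subalgebra of `A`
(with the same unit), `μ` restricts to `lam` and `α` restricts to `φ`. -/
def IsSubsystem (F S : WStarSystem K) : Prop :=
  ∃ h : ∀ b : F.Carrier, (b : K →L[ℂ] K) ∈ S.alg.toStarSubalgebra,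
    (∀ b : F.Carrier, S.trace ⟨b, h b⟩ = F.trace b) ∧
    (∀ b : F.Carrier, (S.aut ⟨b, h b⟩ : K →L[ℂ] K) = (F.aut b : K →L[ℂ] K))

/-- A standard (GNS) representation of a system `(A, μ, α)` on a Hilbert space `H`:
a representation `π` of `A` on `H` with a cyclic vector `Ω` such that `μ(a) = ⟪Ω, π(a)Ω⟫`.
Such a representation is unique up to unitary equivalence, `π` is injective and `Ω` is
automatically separating for `π(A)`, as `μ` is faithful.
If `A` already acts on `H` with a cyclic and separating vector `Ω` that induces `μ`, then `π` can
be taken to be the inclusion. -/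
structure StandardRep (S : WStarSystem K) (H : Type*) [NormedAddCommGroup H]
    [InnerProductSpace ℂ H] [CompleteSpace H] where
  /-- the representation `π` -/
  π : S.Carrier →⋆ₐ[ℂ] (H →L[ℂ] H)
  /-- the cyclic vector `Ω` -/
  Ω : H
  cyclic : DenseRange fun a : S.Carrier => π a Ω
  trace_eq : ∀ a : S.Carrier, S.trace a = ⟪Ω, π a Ω⟫_ℂ

namespace StandardRep

variable {S : WStarSystem K} (R : S.StandardRep H)

/-- The map `a ↦ π(a)Ω` from `A` to `H`. -/
def toH : S.Carrier →ₗ[ℂ] H where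
  toFun a := R.π a R.Ω
  map_add' a b := by simp
  map_smul' c a := by simp

@[simp]
theorem toH_apply (a : S.Carrier) : R.toH a = R.π a R.Ω := rfl

theorem inner_toH (a b : S.Carrier) : ⟪R.toH a, R.toH b⟫_ℂ = S.trace (star a * b) := by
  rw [R.trace_eq, map_mul, map_star, mul_apply_eq_comp,
    ContinuousLinearMap.star_eq_adjoint, ContinuousLinearMap.adjoint_inner_right]
  rfl

theorem norm_toH_eq {a b : S.Carrier} (h : S.trace (star a * a) = S.trace (star b * b)) :
    ‖R.toH a‖ = ‖R.toH b‖ := by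
  rw [← R.inner_toH, ← R.inner_toH, inner_self_eq_norm_sq_to_K, inner_self_eq_norm_sq_to_K] at h
  have h' : ‖R.toH a‖ ^ 2 = ‖R.toH b‖ ^ 2 := by exact_mod_cast h
  exact (sq_eq_sq₀ (norm_nonneg _) (norm_nonneg _)).1 h'

theorem norm_toH_aut (a : S.Carrier) : ‖R.toH (S.aut a)‖ = ‖R.toH a‖ :=
  R.norm_toH_eq (by rw [← map_star, ← map_mul, S.trace_aut])

theorem norm_toH_star (a : S.Carrier) : ‖R.toH (star a)‖ = ‖R.toH a‖ :=
  R.norm_toH_eq (by rw [star_star, S.trace_comm])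

/-- The unitary `U` on `H` that represents the dynamics, `U π(a)Ω = π(α(a))Ω`. -/
def U : H ≃ₗᵢ[ℂ] H :=
  LinearEquiv.extendOfIsometry S.aut.toAlgEquiv.toLinearEquiv R.toH R.toH R.cyclic R.cyclic R.norm_toH_aut

theorem U_apply (a : S.Carrier) : R.U (R.π a R.Ω) = R.π (S.aut a) R.Ω :=
  LinearEquiv.extendOfIsometry_eq (f := S.aut.toAlgEquiv.toLinearEquiv) (e₁ := R.toH) (e₂ := R.toH)
    R.cyclic R.cyclic R.norm_toH_aut a

/-- The modular conjugation `J` of the trace, the conjugate linear isometry of `H` onto itself with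
`J π(a)Ω = π(a*)Ω`. -/
def J : H ≃ₗᵢ⋆[ℂ] H :=
  LinearEquiv.extendOfIsometry (starLinearEquiv ℂ : S.Carrier ≃ₗ⋆[ℂ] S.Carrier) R.toH R.toH
    R.cyclic R.cyclic R.norm_toH_star

theorem J_apply (a : S.Carrier) : R.J (R.π a R.Ω) = R.π (star a) R.Ω :=
  LinearEquiv.extendOfIsometry_eq (f := (starLinearEquiv ℂ : S.Carrier ≃ₗ⋆[ℂ] S.Carrier))
    (e₁ := R.toH) (e₂ := R.toH) R.cyclic R.cyclic R.norm_toH_star a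

/-- The right action of `A` on `H`, `x a := j(a) x = J π(a)* J x`. -/
def rightAct (x : H) (a : S.Carrier) : H := R.J (R.π (star a) (R.J x))

variable (F : WStarSystem K)

/-- The closed subspace `H_F`, the closure of `π(F)Ω`. -/
def HF : ClosedSubmodule ℂ H :=
  (Submodule.span ℂ {x : H | ∃ b : S.Carrier, (b : K →L[ℂ] K) ∈ F.alg ∧ R.π b R.Ω = x}).closure

/-- The projection `e` of `H` onto `H_F`. -/
def e : H →L[ℂ] H := (R.HF F).toSubmodule.starProjection

/-- The basic construction `⟨A, e⟩`: the von Neumann algebra on `H` generated by `π(A)` and `e`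
(see `basicConstruction_isLeast`). -/
def basicConstruction : VonNeumannAlgebra H where
  toStarSubalgebra := StarSubalgebra.centralizer ℂ
    (StarSubalgebra.centralizer ℂ (Set.range R.π ∪ {R.e F}) : Set (H →L[ℂ] H))
  centralizer_centralizer' := by
    change Set.centralizer (Set.centralizer (StarSubalgebra.centralizer ℂ
      (StarSubalgebra.centralizer ℂ (Set.range R.π ∪ {R.e F}) : Set (H →L[ℂ] H)) :
        Set (H →L[ℂ] H))) = (StarSubalgebra.centralizer ℂ
      (StarSubalgebra.centralizer ℂ (Set.range R.π ∪ {R.e F}) : Set (H →L[ℂ] H)) :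
        Set (H →L[ℂ] H))
    rw [StarSubalgebra.coe_centralizer_centralizer, Set.centralizer_centralizer_centralizer]

theorem basicConstruction_isLeast :
    IsLeast {M : VonNeumannAlgebra H | (∀ a, R.π a ∈ M) ∧ R.e F ∈ M}
      (R.basicConstruction F) := by
  have hcoe : (R.basicConstruction F : Set (H →L[ℂ] H)) =
      ((Set.range R.π ∪ {R.e F}) ∪ star (Set.range R.π ∪ {R.e F})).centralizer.centralizer :=
    StarSubalgebra.coe_centralizer_centralizer _ _
  have hsub : (Set.range R.π ∪ {R.e F}) ⊆ (R.basicConstruction F : Set (H →L[ℂ] H)) := by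
    rw [hcoe]
    exact Set.subset_union_left.trans Set.subset_centralizer_centralizer
  refine ⟨⟨fun a => hsub (Or.inl ⟨a, rfl⟩), hsub (Or.inr rfl)⟩, ?_⟩
  rintro M ⟨h1, h2⟩
  change (R.basicConstruction F : Set (H →L[ℂ] H)) ⊆ (M : Set (H →L[ℂ] H))
  have hM : (Set.range R.π ∪ {R.e F}) ⊆ (M : Set (H →L[ℂ] H)) := by
    rintro x (⟨a, rfl⟩ | rfl)
    · exact h1 a
    · exact h2
  rw [hcoe, ← M.centralizer_centralizer]
  refine Set.centralizer_subset (Set.centralizer_subset (Set.union_subset hM ?_))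
  intro x hx
  have : star (star x) ∈ M := star_mem (show star x ∈ M from hM hx)
  rwa [star_star] at this

/-- The positive cone `⟨A, e⟩⁺` of the basic construction. -/
def PosCone : Type _ := {x : H →L[ℂ] H // x ∈ R.basicConstruction F ∧ 0 ≤ x}

/-- The canonical faithful normal semifinite tracial weight on the basic construction,
`⟨A, e⟩⁺ → [0, ∞]`, which is determined by `a e b ↦ μ(ab)`. Its value at `x` is the supremum of
`∑ i, ⟪aᵢΩ, x aᵢΩ⟫` over all finite families `(aᵢ)` in `A` with `∑ i, aᵢ e aᵢ* ≤ 1`.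
Indeed, if `Tr` is the weight with `Tr (a e b) = μ(ab)` and `T = ∑ i, aᵢ e aᵢ*`, then
`∑ i, ⟪aᵢΩ, x aᵢΩ⟫ = ∑ i, Tr (e aᵢ* x aᵢ e) = Tr (x^(1/2) T x^(1/2))`, this is at most `Tr x` if
`T ≤ 1`, and the supremum is `Tr x` because `Tr` is normal and the elements `T ≤ 1` of this form
have `1` in their strong closure (Kaplansky's theorem for the strongly dense `*`-algebra
spanned by the `a e b`). -/
def basicTrace (x : R.PosCone F) : ENNReal :=
  ⨆ (n : ℕ) (a : Fin n → S.Carrier)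
    (_ : ∑ i, R.π (a i) * R.e F * star (R.π (a i)) ≤ (1 : H →L[ℂ] H)),
    ENNReal.ofReal (∑ i, ⟪R.π (a i) R.Ω, x.1 (R.π (a i) R.Ω)⟫_ℂ).re

/-- A closed subspace `V` of `H` is a right-`F`-submodule if `V F ⊆ V`. -/
def IsRightSubmodule (V : ClosedSubmodule ℂ H) : Prop :=
  ∀ x ∈ V, ∀ b : S.Carrier, (b : K →L[ℂ] K) ∈ F.alg → R.rightAct x b ∈ V

/-- A subspace `V` is `U`-invariant if `U V = V`. -/
def IsUInvariant (V : ClosedSubmodule ℂ H) : Prop :=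
  (R.U : H → H) '' (V : Set H) = V

/-- `U`-`μ̄`-modules: the `U`-invariant right-`F`-submodules `V` of `H ⊖ H_F` whose
projection `P_V` (an element of the basic construction) has finite trace. -/
def IsUModule (V : ClosedSubmodule ℂ H) : Prop :=
  V ≤ (R.HF F)ᗮ ∧ R.IsUInvariant V ∧ R.IsRightSubmodule F V ∧
    ∃ h : V.toSubmodule.starProjection ∈ R.basicConstruction F ∧
        0 ≤ V.toSubmodule.starProjection,
      R.basicTrace F ⟨V.toSubmodule.starProjection, h⟩ < ⊤

/-- The closed subspace of `H ⊖ H_F` spanned by all `U`-`μ̄`-modules. -/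
def moduleSpan : ClosedSubmodule ℂ H := sSup {V | R.IsUModule F V}

/-- The system has discrete spectrum relative to its subsystem `F`: the closed span of all
`U`-`μ̄`-modules is `H ⊖ H_F`. -/
def HasDiscreteSpectrum : Prop := R.moduleSpan F = (R.HF F)ᗮ

end StandardRep

end WStarSystem

end

namespace WStarSystem

variable {K : Type*} [NormedAddCommGroup K] [InnerProductSpace ℂ K] [CompleteSpace K]

/-! When `A` is finite-dimensional, so is `H = AΩ`, and the whole complement `H ⊖ H_F` is a single
`U`-`μ̄`-module; as every module lies in it, nothing else is needed. Invariance under `U` and under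
the right action of `F` follows by moving the operators to the other side of the inner product. The
substance is finiteness of the trace: since `Ω ∈ H_F`, one has `|Ω⟩⟨Ω| ≤ ‖Ω‖² e`, hence `|aΩ⟩⟨aΩ| ≤
‖Ω‖² a e a*`. This bounds the supremum defining `basicTrace` at a contraction by `‖Ω‖² dim H`
(`sum_norm_sq_le`, `basicTrace_lt_top`). -/

theorem IsSubsystem.aut_mem {F S : WStarSystem K} (hF : F.IsSubsystem S) {b : S.Carrier}
    (hb : (b : K →L[ℂ] K) ∈ F.alg) : (S.aut b : K →L[ℂ] K) ∈ F.alg := by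
  obtain ⟨h, -, h2⟩ := hF
  have := h2 ⟨b, hb⟩
  change (S.aut b : K →L[ℂ] K) = _ at this
  rw [this]
  exact (F.aut ⟨b, hb⟩).2

/-- The restriction `φ` of `α` is onto `F`, so the `φ`-preimage of `b` is also its `α`-preimage. -/
theorem IsSubsystem.aut_symm_mem {F S : WStarSystem K} (hF : F.IsSubsystem S) {b : S.Carrier}
    (hb : (b : K →L[ℂ] K) ∈ F.alg) : (S.aut.symm b : K →L[ℂ] K) ∈ F.alg := by
  obtain ⟨h, -, h2⟩ := hF
  set c : F.Carrier := F.aut.symm ⟨b, hb⟩ with hc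
  have h3 := h2 c
  rw [hc, F.aut.apply_symm_apply] at h3
  have h4 : S.aut ⟨c, h c⟩ = b := Subtype.ext h3
  rw [← h4, S.aut.symm_apply_apply]
  exact c.2

namespace StandardRep

variable {H : Type*} [NormedAddCommGroup H] [InnerProductSpace ℂ H] [CompleteSpace H]
variable {S : WStarSystem K} (R : S.StandardRep H) (F : WStarSystem K)

/-- The range is dense by cyclicity and closed by finite dimension. -/
theorem toH_surjective [FiniteDimensional ℂ S.Carrier] : Function.Surjective R.toH := by
  have hd : Dense (LinearMap.range R.toH : Set H) := R.cyclic
  have hc : IsClosed (LinearMap.range R.toH : Set H) :=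
    Submodule.closed_of_finiteDimensional _
  intro x
  have : x ∈ (LinearMap.range R.toH : Set H) := by
    rw [← hc.closure_eq]
    exact hd x
  exact this

theorem mem_HF_of_mem {b : S.Carrier} (hb : (b : K →L[ℂ] K) ∈ F.alg) :
    R.π b R.Ω ∈ R.HF F :=
  subset_closure (Submodule.subset_span ⟨b, hb, rfl⟩)

theorem Ω_mem_HF : R.Ω ∈ R.HF F := by
  simpa using R.mem_HF_of_mem F (b := 1) (one_mem F.alg)

theorem mem_HF_orthogonal_iff {x : H} :
    x ∈ (R.HF F)ᗮ ↔ ∀ b : S.Carrier, (b : K →L[ℂ] K) ∈ F.alg → ⟪R.π b R.Ω, x⟫_ℂ = 0 := by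
  refine ⟨fun hx b hb => hx _ (R.mem_HF_of_mem F hb), fun hx => ?_⟩
  change x ∈ (Submodule.topologicalClosure _)ᗮ
  rw [Submodule.orthogonal_closure, Submodule.mem_orthogonal]
  intro u hu
  induction hu using Submodule.span_induction with
  | mem u hu =>
    obtain ⟨b, hb, rfl⟩ := hu
    exact hx b hb
  | zero => simp
  | add u v _ _ hu hv => rw [inner_add_left, hu, hv, add_zero]
  | smul c u _ hu => rw [inner_smul_left, hu, mul_zero]

variable {F}

/-- `U` is unitary. The inclusion `UV ⊆ V` needs `α⁻¹(F) ⊆ F`, and `V ⊆ UV` needs `α(F) ⊆ F`. -/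
theorem isUInvariant_HF_orthogonal (hF : F.IsSubsystem S) : R.IsUInvariant (R.HF F)ᗮ := by
  ext x
  constructor
  · rintro ⟨y, hy, rfl⟩
    refine (R.mem_HF_orthogonal_iff F).2 fun b hb => ?_
    have h := (R.mem_HF_orthogonal_iff F).1 hy _ (hF.aut_symm_mem hb)
    rwa [← R.U.inner_map_map, R.U_apply, S.aut.apply_symm_apply] at h
  · intro hx
    refine ⟨R.U.symm x, (R.mem_HF_orthogonal_iff F).2 fun b hb => ?_, R.U.apply_symm_apply x⟩
    have h := (R.mem_HF_orthogonal_iff F).1 hx _ (hF.aut_mem hb)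
    rwa [← R.U.inner_map_map, R.U_apply, R.U.apply_symm_apply]

theorem rightAct_toH (a b : S.Carrier) : R.rightAct (R.toH a) b = R.toH (a * b) := by
  have h : R.π (star b) (R.π (star a) R.Ω) = R.π (star (a * b)) R.Ω := by
    rw [star_mul, map_mul, mul_apply_eq_comp]
  rw [rightAct, toH_apply, J_apply, h, J_apply, star_star, toH_apply]

variable (F)

/-- By traciality, right multiplication by `b` has adjoint right multiplication by `b*`: `μ(c* a b)
= μ((c b*)* a)`, and `c b*` stays in `F`. -/
theorem isRightSubmodule_HF_orthogonal [FiniteDimensional ℂ S.Carrier] :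
    R.IsRightSubmodule F (R.HF F)ᗮ := by
  intro x hx b hb
  obtain ⟨a, rfl⟩ := R.toH_surjective x
  rw [rightAct_toH, mem_HF_orthogonal_iff]
  intro c hc
  have h := (R.mem_HF_orthogonal_iff F).1 hx (c * star b) (mul_mem hc (star_mem hb))
  rw [← toH_apply, inner_toH] at h ⊢
  rwa [star_mul, star_star, mul_assoc, S.trace_comm, mul_assoc] at h

theorem starProjection_HF_orthogonal :
    ((R.HF F)ᗮ).toSubmodule.starProjection = 1 - R.e F :=
  Submodule.starProjection_orthogonal _

theorem starProjection_HF_orthogonal_mem :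
    ((R.HF F)ᗮ).toSubmodule.starProjection ∈ R.basicConstruction F := by
  rw [starProjection_HF_orthogonal]
  exact sub_mem (one_mem _) (R.basicConstruction_isLeast F).1.2

/-- The rank one operator of `π(a)Ω` is dominated by `‖Ω‖² a e a*`. -/
theorem norm_inner_sq_le (a : S.Carrier) (v : H) :
    ‖⟪v, R.π a R.Ω⟫_ℂ‖ ^ 2 ≤
      ‖R.Ω‖ ^ 2 * (⟪v, (R.π a * R.e F * star (R.π a)) v⟫_ℂ).re := by
  set w := star (R.π a) v with hw
  -- As `e Ω = Ω`, the vector `w` may be replaced by `e w`; Cauchy–Schwarz then gives the bound.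
  have h1 : ⟪v, R.π a R.Ω⟫_ℂ = ⟪R.e F w, R.Ω⟫_ℂ := by
    rw [e, Submodule.inner_starProjection_left_eq_right,
      Submodule.starProjection_eq_self_iff.2 (R.Ω_mem_HF F), hw,
      ContinuousLinearMap.star_eq_adjoint, ContinuousLinearMap.adjoint_inner_left]
  have h2 : ⟪v, (R.π a * R.e F * star (R.π a)) v⟫_ℂ = ⟪w, R.e F w⟫_ℂ := by
    rw [hw, ContinuousLinearMap.star_eq_adjoint, ContinuousLinearMap.adjoint_inner_left]
    rfl
  have h3 : (⟪w, R.e F w⟫_ℂ).re = ‖R.e F w‖ ^ 2 := by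
    have : R.e F (R.e F w) = R.e F w :=
      Submodule.starProjection_eq_self_iff.2 (Submodule.starProjection_apply_mem _ _)
    rw [← this, e, ← Submodule.inner_starProjection_left_eq_right, ← e, this]
    exact inner_self_eq_norm_sq (𝕜 := ℂ) _
  rw [h1, h2, h3, ← mul_pow, mul_comm]
  gcongr
  exact norm_inner_le_norm _ _

/-- The rank one operators of the `aᵢΩ` sum to at most `‖Ω‖² ∑ aᵢ e aᵢ* ≤ ‖Ω‖²`; taking the matrix
trace in an orthonormal basis yields the factor `dim H`. -/
theorem sum_norm_sq_le [FiniteDimensional ℂ H] {n : ℕ} (a : Fin n → S.Carrier)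
    (ha : ∑ i, R.π (a i) * R.e F * star (R.π (a i)) ≤ (1 : H →L[ℂ] H)) :
    ∑ i, ‖R.π (a i) R.Ω‖ ^ 2 ≤ ‖R.Ω‖ ^ 2 * Module.finrank ℂ H := by
  let B := stdOrthonormalBasis ℂ H
  have key (j) : ∑ i, ‖⟪B j, R.π (a i) R.Ω⟫_ℂ‖ ^ 2 ≤ ‖R.Ω‖ ^ 2 := by
    have h := (ContinuousLinearMap.nonneg_iff_isPositive _).1 (sub_nonneg.2 ha)
    have h := h.re_inner_nonneg_right (B j)
    rw [sub_apply, inner_sub_right, map_sub, sub_nonneg, one_apply_eq_self,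
      inner_self_eq_norm_sq, B.norm_eq_one, sum_apply, inner_sum, map_sum] at h
    calc _ ≤ ∑ i, ‖R.Ω‖ ^ 2 *
          (⟪B j, (R.π (a i) * R.e F * star (R.π (a i))) (B j)⟫_ℂ).re :=
          Finset.sum_le_sum fun i _ => R.norm_inner_sq_le F (a i) (B j)
      _ ≤ ‖R.Ω‖ ^ 2 * 1 := by
          rw [← Finset.mul_sum]
          gcongr
          simpa using h
      _ = _ := mul_one _
  rw [Finset.sum_congr rfl fun i _ => (B.sum_sq_norm_inner_right (R.π (a i) R.Ω)).symm,
    Finset.sum_comm]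
  refine (Finset.sum_le_sum fun j _ => key j).trans_eq ?_
  simp [mul_comm]

/-- On a finite-dimensional space the canonical trace takes finite values at contractions. -/
theorem basicTrace_lt_top [FiniteDimensional ℂ H] (x : R.PosCone F) (hx : ‖x.1‖ ≤ 1) :
    R.basicTrace F x < ⊤ := by
  refine lt_of_le_of_lt (b := ENNReal.ofReal (‖R.Ω‖ ^ 2 * Module.finrank ℂ H)) ?_
    ENNReal.ofReal_lt_top
  refine iSup_le fun n => iSup_le fun a => iSup_le fun ha => ENNReal.ofReal_le_ofReal ?_
  refine le_trans ?_ (R.sum_norm_sq_le F a ha)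
  rw [Complex.re_sum]
  refine Finset.sum_le_sum fun i _ => ?_
  -- For a contraction `x`, each term `⟪aᵢΩ, x aᵢΩ⟫` has real part at most `‖aᵢΩ‖²`.
  refine (Complex.re_le_norm _).trans ((norm_inner_le_norm _ _).trans ?_)
  rw [sq]
  gcongr
  exact (x.1.le_of_opNorm_le hx _).trans_eq (one_mul _)

theorem isUModule_HF_orthogonal [FiniteDimensional ℂ S.Carrier] (hF : F.IsSubsystem S) :
    R.IsUModule F (R.HF F)ᗮ := by
  have : FiniteDimensional ℂ H := Module.Finite.of_surjective R.toH R.toH_surjective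
  refine ⟨le_rfl, R.isUInvariant_HF_orthogonal hF, R.isRightSubmodule_HF_orthogonal F,
    ⟨R.starProjection_HF_orthogonal_mem F, ?_⟩, ?_⟩
  · exact (ContinuousLinearMap.nonneg_iff_isPositive _).2
      (ContinuousLinearMap.IsPositive.of_isStarProjection isStarProjection_starProjection)
  · exact R.basicTrace_lt_top F _ (Submodule.starProjection_norm_le _)

end StandardRep

end WStarSystem

theorem mainTheorem10 {K : Type*} [NormedAddCommGroup K] [InnerProductSpace ℂ K] [CompleteSpace K]
    (A F : WStarSystem K) (hA : FiniteDimensional ℂ A.Carrier) (hF : F.IsSubsystem A)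
    {H : Type*} [NormedAddCommGroup H] [InnerProductSpace ℂ H] [CompleteSpace H]
    (R : A.StandardRep H) :
    R.HasDiscreteSpectrum F :=
  le_antisymm (sSup_le fun _ hV => hV.1) (le_sSup (R.isUModule_HF_orthogonal F hF))
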